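/- **Efron's inequality for the wrapping hull.** Let $d\ge 0$, let $\mathbf E\subset\mathbb R^d$ be compact and convex, and let $\mathbf A$ be a family of compact subsets of $\mathbf E$ with $\varnothing,\mathbf E\in\mathbf A$ that is closed under arbitrary intersections. For $S\subseteq \mathbf E$ put $\operatorname{wrap}_{\mathbf A}(S)=\bigcap\{B\in\mathbf A: S\subseteq B\}$. Assume that $(x_1,\dots,x_n)\mapsto\operatorname{wrap}_{\mathbf A}\{x_1,\dots,x_n\}$, $\mathbf E^n\to\{\text{compact subsets of }\mathbf E\}$, is Borel measurable for every $n$ (Hausdorff metric, with $\varnothing$ as an isolated point). Let $A\in\mathbf A$ have positive Lebesgue measure $|A|>0$, let $\lambda>0$, and let $X_1,\dots,X_N$ be a Poisson point process of intensity $\lambda$ on $A$; that is, $X_1,X_2,\dots$ are i.i.d. uniform on $A$ and $N\sim\mathrm{Poiss}(\lambda|A|)$ is independent of $(X_i)_{i\ge1}$. Let $\hat A=\operatorname{wrap}_{\mathbf A}\{X_1,\dots,X_N\}$ be the wrapping hull and let $N_\partial=\#\{i\le N: X_i\in\partial\hat A\}$ be the number of points on its topological boundary. Assume that $|\partial\hat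 A|=0$ almost surely. Then for every integer $q\ge 0$ (with $0^0=1$), $$\mathbb E[N_\partial^q]\;\lesssim\;\lambda^q\,\mathbb E\big[|A\setminus\hat A|^q\big],$$ provided that the probability of observing at least $q$ points on the boundary of $\hat A$ is non-zero, where the implied constant depends only on $q$ and on this probability, and is non-increasing in the latter. Precisely: for every integer $q\ge0$ there is a non-increasing function $C_q:(0,\infty)\to\mathbb R$ such that for all $d,\mathbf E,\mathbf A,A,\lambda$ and all samples as above with $\mathbb P(N_\partial\ge q)>0$, $$\mathbb E[N_\partial^q]\le C_q\big(\mathbb P(N_\partial\ge q)\big)\,\lambda^q\,\mathbb E\big[|A\setminus\hat A|^q\big].$$ In particular the constant is uniform in $\lambda$ (and in $A$, $\mathbf A$, $d$) as long as $\mathbb P(N_\partial\ge q)$ stays bounded away from $0$. -/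

import Mathlib

open MeasureTheory ProbabilityTheory
open scoped ENNReal NNReal

/-- An intersection-stable class `𝓐` of compact subsets of `E`: it contains `∅` and `E` and is
closed under arbitrary intersections (the empty intersection being `E`). -/
structure IsIntersectionStable {d : ℕ} (E : Set (EuclideanSpace ℝ (Fin d)))
    (𝓐 : Set (Set (EuclideanSpace ℝ (Fin d)))) : Prop where
  subset_of_mem : ∀ B ∈ 𝓐, B ⊆ E
  isCompact_of_mem : ∀ B ∈ 𝓐, IsCompact B
  empty_mem : ∅ ∈ 𝓐
  univ_mem : E ∈ 𝓐
  sInter_mem : ∀ S ⊆ 𝓐, S.Nonempty → ⋂₀ S ∈ 𝓐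

/-- `wrap 𝓐 S` is the intersection of all members of the class `𝓐` that contain `S`. -/
def wrap {d : ℕ} (𝓐 : Set (Set (EuclideanSpace ℝ (Fin d))))
    (S : Set (EuclideanSpace ℝ (Fin d))) : Set (EuclideanSpace ℝ (Fin d)) :=
  ⋂₀ {B | B ∈ 𝓐 ∧ S ⊆ B}

/-- The wrapping hull is a measurable map from finite point configurations in `E` to the compact
subsets of `E`. The Borel σ-algebra of the Hausdorff metric on compact subsets of `E` is
generated by the sets `{K | K ⊆ B}` with `B ⊆ E` compact. -/
def MeasurableWrap {d : ℕ} (E : Set (EuclideanSpace ℝ (Fin d)))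
    (𝓐 : Set (Set (EuclideanSpace ℝ (Fin d)))) : Prop :=
  ∀ (n : ℕ) (B : Set (EuclideanSpace ℝ (Fin d))), IsCompact B → B ⊆ E →
    MeasurableSet {x : Fin n → EuclideanSpace ℝ (Fin d) |
      (∀ i, x i ∈ E) ∧ wrap 𝓐 (Set.range x) ⊆ B}

/-- The points `X 0, …, X (N - 1)` form a homogeneous Poisson point process of intensity `lam`
on `A`: the `X i` are i.i.d. uniform on `A`, the number `N` of points is Poisson distributed with
parameter `lam * |A|`, and `N` is independent of the sequence `X`. -/
structure IsPoissonSample {d : ℕ} {Ω : Type*} [MeasurableSpace Ω] (μ : Measure Ω)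
    (lam : ℝ) (A : Set (EuclideanSpace ℝ (Fin d)))
    (X : ℕ → Ω → EuclideanSpace ℝ (Fin d)) (N : Ω → ℕ) : Prop where
  measurable_point : ∀ i, Measurable (X i)
  measurable_number : Measurable N
  isUniform : ∀ i, pdf.IsUniform (X i) A μ volume
  iIndepFun_points : iIndepFun X μ
  map_number : μ.map N = poissonMeasure (lam * (volume A).toReal).toNNReal
  indepFun_number : IndepFun N (fun ω i => X i ω) μ

/-- The random set `{X 0, …, X (N - 1)}` of observed points. -/
def observedPoints {d : ℕ} {Ω : Type*} (X : ℕ → Ω → EuclideanSpace ℝ (Fin d)) (N : Ω → ℕ)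
    (ω : Ω) : Set (EuclideanSpace ℝ (Fin d)) :=
  {x | ∃ i < N ω, X i ω = x}

/-- The wrapping hull of the observed points. -/
def wrappingHull {d : ℕ} {Ω : Type*} (𝓐 : Set (Set (EuclideanSpace ℝ (Fin d))))
    (X : ℕ → Ω → EuclideanSpace ℝ (Fin d)) (N : Ω → ℕ) (ω : Ω) :
    Set (EuclideanSpace ℝ (Fin d)) :=
  wrap 𝓐 (observedPoints X N ω)

open Classical in
/-- The number of observed points that lie in `B`. -/
noncomputable def pointCount {d : ℕ} {Ω : Type*} (X : ℕ → Ω → EuclideanSpace ℝ (Fin d))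
    (N : Ω → ℕ) (ω : Ω) (B : Set (EuclideanSpace ℝ (Fin d))) : ℕ :=
  ((Finset.range (N ω)).filter fun i => X i ω ∈ B).card

/-- The number of observed points on the topological boundary of the wrapping hull. -/
noncomputable def boundaryCount {d : ℕ} {Ω : Type*}
    (𝓐 : Set (Set (EuclideanSpace ℝ (Fin d))))
    (X : ℕ → Ω → EuclideanSpace ℝ (Fin d)) (N : Ω → ℕ) (ω : Ω) : ℕ :=
  pointCount X N ω (frontier (wrappingHull 𝓐 X N ω))

/-! For a finite sample, count the `q`-subsets `T` of indices whose points all lie in a set `K`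
built from the other points. Given the others, the points of `T` are i.i.d. uniform, and the Poisson
weights turn the removal of `q` points into a factor `r ^ q`. This gives Mecke's formula
`factorial_mul_lintegral_card_exposedSubsets`, which is used twice. With `K` the frontier of the
hull and `q = 1`, the assumption of a null boundary shows that almost surely no point lies on the
frontier of the hull of the others. Hence deleting any boundary point changes the hull, every
`q`-set of boundary points avoids the hull of the rest, and `choose_card_le_card_exposedSubsets`
applies. With `K` the complement of the hull, the expected count of such `q`-sets is at most `lam ^
q * E|A \ hull| ^ q / q!`. A binomial coefficient controls `n ^ q` only up to an additive constant;
the constant is absorbed using `P(boundaryCount ≥ q) > 0`. -/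

open Classical in
/-- The `q`-element sets of indices below `n` all of whose points lie in the value of `K` at the
set of the remaining points. -/
noncomputable def exposedSubsets {V : Type*} (K : Set V → Set V) (q n : ℕ) (x : ℕ → V) :
    Finset (Finset ℕ) :=
  ((Finset.range n).powersetCard q).filter fun T =>
    ∀ i ∈ T, x i ∈ K (x '' ↑(Finset.range n \ T))

theorem mem_exposedSubsets {V : Type*} {K : Set V → Set V} {q n : ℕ} {x : ℕ → V}
    {T : Finset ℕ} : T ∈ exposedSubsets K q n x ↔
      (T ⊆ Finset.range n ∧ T.card = q) ∧ ∀ i ∈ T, x i ∈ K (x '' ↑(Finset.range n \ T)) := by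
  simp only [exposedSubsets, Finset.mem_filter, Finset.mem_powersetCard]

theorem coe_card_exposedSubsets {V : Type*} (K : Set V → Set V) (q n : ℕ) (x : ℕ → V) :
    ((exposedSubsets K q n x).card : ℝ≥0∞) = ∑ T ∈ (Finset.range n).powersetCard q,
      {x : ℕ → V | ∀ i ∈ T, x i ∈ K (x '' ↑(Finset.range n \ T))}.indicator 1 x := by
  classical
  rw [exposedSubsets, Finset.card_filter]
  push_cast
  refine Finset.sum_congr rfl fun T _ => ?_
  simp only [Set.indicator_apply, Set.mem_ofPred_eq, Pi.one_apply]

theorem measurable_comp_index_sequence {Ω V : Type*} [MeasurableSpace Ω] [MeasurableSpace V]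
    {X : ℕ → Ω → V} {N : Ω → ℕ} (hN : Measurable N) (hX : ∀ i, Measurable (X i))
    (F : ℕ → (ℕ → V) → ℝ≥0∞) (hF : ∀ n, Measurable (F n)) :
    Measurable fun ω => F (N ω) (fun i => X i ω) := by
  have hF' : Measurable (fun p : ℕ × (ℕ → V) => F p.1 p.2) :=
    measurable_from_prod_countable_right hF
  exact hF'.comp (hN.prodMk (measurable_pi_lambda _ hX))

/-! ### Mecke's formula for a Poisson number of i.i.d. points. -/

section IndependentSequence

variable {Ω V : Type*} [MeasurableSpace Ω] [MeasurableSpace V] {μ : Measure Ω}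
  [IsProbabilityMeasure μ] {ν : Measure V} {X : ℕ → Ω → V} {N : Ω → ℕ}

theorem lintegral_comp_index_sequence (hN : Measurable N) (hX : ∀ i, Measurable (X i))
    (hind : IndepFun N (fun ω i => X i ω) μ) (F : ℕ → (ℕ → V) → ℝ≥0∞)
    (hF : ∀ n, Measurable (F n)) :
    ∫⁻ ω, F (N ω) (fun i => X i ω) ∂μ =
      ∑' n, μ.map N {n} * ∫⁻ ω, F n (fun i => X i ω) ∂μ := by
  have hX' : Measurable (fun ω i => X i ω) := measurable_pi_lambda _ hX
  have hF' : Measurable (fun p : ℕ × (ℕ → V) => F p.1 p.2) :=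
    measurable_from_prod_countable_right hF
  have : IsProbabilityMeasure (μ.map N) := Measure.isProbabilityMeasure_map hN.aemeasurable
  have : IsProbabilityMeasure (μ.map (fun ω i => X i ω)) :=
    Measure.isProbabilityMeasure_map hX'.aemeasurable
  have h := (indepFun_iff_map_prod_eq_prod_map_map hN.aemeasurable hX'.aemeasurable).1 hind
  calc ∫⁻ ω, F (N ω) (fun i => X i ω) ∂μ
      = ∫⁻ p, F p.1 p.2 ∂(μ.map (fun ω => (N ω, fun i => X i ω))) :=
        (lintegral_map hF' (hN.prodMk hX')).symm
    _ = ∑' n, μ.map N {n} * ∫⁻ x, F n x ∂(μ.map (fun ω i => X i ω)) := by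
        rw [h, lintegral_prod _ hF'.aemeasurable, lintegral_countable']
        simp_rw [mul_comm]
    _ = _ := by simp_rw [lintegral_map (hF _) hX']

theorem map_subfamily_eq_pi (hX : ∀ i, Measurable (X i)) (hi : iIndepFun X μ)
    (hν : ∀ i, μ.map (X i) = ν) {ι : Type*} [Fintype ι] {e : ι → ℕ}
    (he : Function.Injective e) :
    μ.map (fun ω a => X (e a) ω) = Measure.pi fun _ => ν := by
  have := (iIndepFun_iff_map_fun_eq_pi_map (fun a => (hX (e a)).aemeasurable)).1
    (hi.precomp he)
  simpa only [hν] using this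

/-- Fubini: once the block of `m` points is fixed, the other `q` points are independent and each
hits the section with the same probability. -/
theorem measure_forall_mem_section (hX : ∀ i, Measurable (X i)) (hi : iIndepFun X μ)
    (hν : ∀ i, μ.map (X i) = ν) {q m : ℕ} {e : Fin q ⊕ Fin m → ℕ}
    (he : Function.Injective e) {D : Set ((Fin m → V) × V)} (hD : MeasurableSet D) :
    μ {ω | ∀ i, (fun j => X (e (Sum.inr j)) ω, X (e (Sum.inl i)) ω) ∈ D} =
      ∫⁻ x, ν (Prod.mk x ⁻¹' D) ^ q ∂(Measure.pi fun _ : Fin m => ν) := by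
  have : IsProbabilityMeasure ν := by
    rw [← hν 0]; exact Measure.isProbabilityMeasure_map (hX 0).aemeasurable
  have hm : Measurable (fun ω a => X (e a) ω) := measurable_pi_lambda _ fun a => hX _
  have h1 : MeasurePreserving (fun ω a => X (e a) ω) μ (Measure.pi fun _ => ν) :=
    ⟨hm, map_subfamily_eq_pi hX hi hν he⟩
  have h2 := (measurePreserving_sumPiEquivProdPi (ι := Fin q) (ι' := Fin m)
    (X := fun _ => V) (fun _ => ν)).comp h1
  have hset : MeasurableSet {p : (Fin q → V) × (Fin m → V) | ∀ i, (p.2, p.1 i) ∈ D} := by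
    rw [Set.ofPred_forall]
    exact MeasurableSet.iInter fun i =>
      (measurable_snd.prodMk ((measurable_pi_apply i).comp measurable_fst)) hD
  have h3 := h2.measure_preimage hset.nullMeasurableSet
  rw [Measure.prod_apply_symm hset] at h3
  refine Eq.trans ?_ (h3.trans ?_)
  · rfl
  · refine lintegral_congr fun x => ?_
    have : (fun p : Fin q → V => (p, x)) ⁻¹' {p | ∀ i, (p.2, p.1 i) ∈ D} =
        Set.univ.pi fun _ => Prod.mk x ⁻¹' D := by
      ext; simp
    rw [this, Measure.pi_pi]
    simp

theorem measurableSet_mem_of_finset {K : Set V → Set V}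
    (hK : ∀ m, MeasurableSet {p : (Fin m → V) × V | p.2 ∈ K (Set.range p.1)})
    (S : Finset ℕ) (i : ℕ) : MeasurableSet {x : ℕ → V | x i ∈ K (x '' ↑S)} := by
  have h : Measurable (fun x : ℕ → V => (fun j => x (S.orderEmbOfFin rfl j), x i)) :=
    (measurable_pi_lambda _ fun j => measurable_pi_apply _).prodMk (measurable_pi_apply i)
  convert h (hK S.card) using 1
  ext x
  simp only [Set.mem_ofPred_eq, Set.mem_preimage]
  rw [← S.range_orderEmbOfFin rfl, ← Set.range_comp]
  rfl

theorem measure_forall_mem_of_disjoint (hX : ∀ i, Measurable (X i)) (hi : iIndepFun X μ)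
    (hν : ∀ i, μ.map (X i) = ν) {K : Set V → Set V}
    (hK : ∀ m, MeasurableSet {p : (Fin m → V) × V | p.2 ∈ K (Set.range p.1)})
    {S T : Finset ℕ} (hST : Disjoint T S) {q m : ℕ} (hT : T.card = q) (hS : S.card = m) :
    μ {ω | ∀ i ∈ T, X i ω ∈ K ((fun j => X j ω) '' ↑S)} =
      ∫⁻ x, ν (K (Set.range x)) ^ q ∂(Measure.pi fun _ : Fin m => ν) := by
  have he : Function.Injective
      (Sum.elim (T.orderEmbOfFin hT) (S.orderEmbOfFin hS)) := by
    refine Function.Injective.sumElim (T.orderEmbOfFin hT).injective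
      (S.orderEmbOfFin hS).injective fun a b hab => ?_
    exact Finset.disjoint_left.1 hST (T.orderEmbOfFin_mem hT a)
      (hab ▸ S.orderEmbOfFin_mem hS b)
  refine Eq.trans (congrArg μ ?_) (measure_forall_mem_section hX hi hν he (hK m))
  ext ω
  simp only [Set.mem_ofPred_eq, Sum.elim_inl, Sum.elim_inr]
  rw [← S.range_orderEmbOfFin hS, ← Set.range_comp]
  constructor
  · exact fun h i => h _ (T.orderEmbOfFin_mem hT i)
  · intro h i hi
    rw [← Finset.mem_coe, ← T.range_orderEmbOfFin hT] at hi
    obtain ⟨a, rfl⟩ := hi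
    exact h a

/-- The only place where the form of the Poisson weights matters: the binomial coefficient counts
the ways to remove `q` points from `m + q`. -/
theorem poissonMeasure_singleton_add (r : ℝ≥0) (m q : ℕ) :
    ((m + q).choose q : ℝ≥0∞) * (q.factorial * poissonMeasure r {m + q}) =
      r ^ q * poissonMeasure r {m} := by
  rw [poissonMeasure_singleton, poissonMeasure_singleton]
  have h1 : (r : ℝ≥0∞) = ENNReal.ofReal r := by simp
  rw [← ENNReal.ofReal_natCast, ← ENNReal.ofReal_natCast, h1, ← ENNReal.ofReal_pow (by simp),
    ← ENNReal.ofReal_mul (by positivity), ← ENNReal.ofReal_mul (by positivity),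
    ← ENNReal.ofReal_mul (by positivity)]
  congr 1
  have h := Nat.add_choose_mul_factorial_mul_factorial m q
  have h' : (((m + q).choose q : ℕ) : ℝ) * m.factorial * q.factorial = (m + q).factorial := by
    exact_mod_cast h
  have : (0 : ℝ) < (m + q).factorial := by positivity
  have : (0 : ℝ) < m.factorial := by positivity
  field_simp
  rw [← h', pow_add]
  ring

theorem measurableSet_forall_mem_sdiff {K : Set V → Set V}
    (hK : ∀ m, MeasurableSet {p : (Fin m → V) × V | p.2 ∈ K (Set.range p.1)})
    (S T : Finset ℕ) : MeasurableSet {x : ℕ → V | ∀ i ∈ T, x i ∈ K (x '' ↑S)} := by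
  simp only [Set.ofPred_forall]
  exact MeasurableSet.biInter T.countable_toSet fun i _ => measurableSet_mem_of_finset hK _ _

theorem measurable_card_exposedSubsets {K : Set V → Set V}
    (hK : ∀ m, MeasurableSet {p : (Fin m → V) × V | p.2 ∈ K (Set.range p.1)}) (q n : ℕ) :
    Measurable fun x : ℕ → V => ((exposedSubsets K q n x).card : ℝ≥0∞) := by
  simp only [coe_card_exposedSubsets]
  exact Finset.measurable_fun_sum _ fun T _ =>
    measurable_one.indicator (measurableSet_forall_mem_sdiff hK _ _)

theorem lintegral_card_exposedSubsets (hX : ∀ i, Measurable (X i)) (hi : iIndepFun X μ)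
    (hν : ∀ i, μ.map (X i) = ν) {K : Set V → Set V}
    (hK : ∀ m, MeasurableSet {p : (Fin m → V) × V | p.2 ∈ K (Set.range p.1)}) (q m : ℕ) :
    ∫⁻ ω, ((exposedSubsets K q (m + q) fun i => X i ω).card : ℝ≥0∞) ∂μ =
      (m + q).choose q *
        ∫⁻ x, ν (K (Set.range x)) ^ q ∂(Measure.pi fun _ : Fin m => ν) := by
  have hX' : Measurable (fun ω i => X i ω) := measurable_pi_lambda _ hX
  simp only [coe_card_exposedSubsets]
  have hm (T : Finset ℕ) : Measurable fun ω =>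
      {x : ℕ → V | ∀ i ∈ T, x i ∈ K (x '' ↑(Finset.range (m + q) \ T))}.indicator
        (1 : (ℕ → V) → ℝ≥0∞) fun i => X i ω :=
    (measurable_one.indicator (measurableSet_forall_mem_sdiff hK _ T)).comp hX'
  rw [lintegral_finsetSum _ fun T _ => hm T]
  rw [Finset.sum_congr rfl (g := fun _ =>
    ∫⁻ x, ν (K (Set.range x)) ^ q ∂(Measure.pi fun _ : Fin m => ν))]
  · simp
  · intro T hT
    rw [Finset.mem_powersetCard] at hT
    rw [← measure_forall_mem_of_disjoint hX hi hν hK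
      (Finset.disjoint_sdiff (s := T) (t := Finset.range (m + q))) hT.2
      (by rw [Finset.card_sdiff_of_subset hT.1, hT.2]; simp)]
    exact lintegral_indicator_one (hX' (measurableSet_forall_mem_sdiff hK _ T))

/-- The multivariate Mecke formula for the numbers of `q`-subsets of a Poisson sample whose points
lie in a random set determined by the remaining points. -/
theorem factorial_mul_lintegral_card_exposedSubsets (hX : ∀ i, Measurable (X i))
    (hi : iIndepFun X μ) (hν : ∀ i, μ.map (X i) = ν) (hN : Measurable N) {r : ℝ≥0}
    (hNr : μ.map N = poissonMeasure r) (hind : IndepFun N (fun ω i => X i ω) μ)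
    {K : Set V → Set V}
    (hK : ∀ m, MeasurableSet {p : (Fin m → V) × V | p.2 ∈ K (Set.range p.1)}) (q : ℕ) :
    q.factorial * ∫⁻ ω, ((exposedSubsets K q (N ω) fun i => X i ω).card : ℝ≥0∞) ∂μ =
      r ^ q * ∫⁻ ω, ν (K ((fun i => X i ω) '' ↑(Finset.range (N ω)))) ^ q ∂μ := by
  have : IsProbabilityMeasure ν := by
    rw [← hν 0]; exact Measure.isProbabilityMeasure_map (hX 0).aemeasurable
  have hg (m : ℕ) : Measurable fun x : Fin m → V => ν (K (Set.range x)) ^ q :=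
    (measurable_measure_prodMk_left (ν := ν) (hK m)).pow_const q
  have hrange (n : ℕ) (x : ℕ → V) :
      x '' ↑(Finset.range n) = Set.range fun i : Fin n => x i := by
    ext y; simp [Fin.exists_iff]
  have hres (n : ℕ) : Measurable fun (x : ℕ → V) (i : Fin n) => x i :=
    measurable_pi_lambda _ fun i => measurable_pi_apply _
  have hL := lintegral_comp_index_sequence hN hX hind
    (fun n x => ((exposedSubsets K q n x).card : ℝ≥0∞)) (measurable_card_exposedSubsets hK q)
  have hR := lintegral_comp_index_sequence hN hX hind
    (fun n x => ν (K (x '' ↑(Finset.range n))) ^ q)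
    (fun n => by simp only [hrange]; exact (hg n).comp (hres n))
  have hL' (n : ℕ) (hn : n ∈ Finset.range q) : (q.factorial : ℝ≥0∞) * (poissonMeasure r {n} *
      ∫⁻ ω, ((exposedSubsets K q n fun i => X i ω).card : ℝ≥0∞) ∂μ) = 0 := by
    have : (Finset.range n).powersetCard q = ∅ :=
      Finset.powersetCard_eq_empty.2 (by simpa using hn)
    simp [exposedSubsets, this]
  have hR' (m : ℕ) : ∫⁻ ω, ν (K ((fun i => X i ω) '' ↑(Finset.range m))) ^ q ∂μ =
      ∫⁻ x, ν (K (Set.range x)) ^ q ∂(Measure.pi fun _ : Fin m => ν) := by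
    simp only [hrange]
    rw [← map_subfamily_eq_pi hX hi hν (e := fun i : Fin m => (i : ℕ)) Fin.val_injective,
      lintegral_map (hg m) (measurable_pi_lambda _ fun i => hX _)]
  rw [hL, hR, ← ENNReal.tsum_mul_left, ← ENNReal.tsum_mul_left, hNr]
  -- Samples with fewer than `q` points have no `q`-subsets, so the left series is reindexed by `m`,
  -- the number of points that remain.
  rw [← Summable.sum_add_tsum_nat_add' (k := q) ENNReal.summable]
  rw [Finset.sum_eq_zero hL', zero_add]
  refine tsum_congr fun m => ?_
  rw [lintegral_card_exposedSubsets hX hi hν hK, hR']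
  generalize ∫⁻ x, ν (K (Set.range x)) ^ q ∂(Measure.pi fun _ : Fin m => ν) = c
  rw [← mul_assoc ((r : ℝ≥0∞) ^ q), ← poissonMeasure_singleton_add]
  ac_rfl

end IndependentSequence

/-! ### Measurability of the hull and its deterministic geometry. -/

section Wrap

variable {d : ℕ} {E : Set (EuclideanSpace ℝ (Fin d))}
  {𝓐 : Set (Set (EuclideanSpace ℝ (Fin d)))}

theorem subset_wrap (S : Set (EuclideanSpace ℝ (Fin d))) : S ⊆ wrap 𝓐 S :=
  fun _ hx _ hB => hB.2 hx

theorem wrap_mono {S T : Set (EuclideanSpace ℝ (Fin d))} (h : S ⊆ T) :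
    wrap 𝓐 S ⊆ wrap 𝓐 T :=
  fun _ hx B hB => hx B ⟨hB.1, h.trans hB.2⟩

theorem wrap_subset_wrap_of_subset {S T : Set (EuclideanSpace ℝ (Fin d))} (h : T ⊆ wrap 𝓐 S) :
    wrap 𝓐 T ⊆ wrap 𝓐 S :=
  fun _ hx B hB => hx B ⟨hB.1, fun _ hy => h hy B hB⟩

theorem IsIntersectionStable.wrap_mem (h : IsIntersectionStable E 𝓐)
    {S : Set (EuclideanSpace ℝ (Fin d))} (hS : S ⊆ E) : wrap 𝓐 S ∈ 𝓐 :=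
  h.sInter_mem _ (fun _ hB => hB.1) ⟨E, h.univ_mem, hS⟩

theorem IsIntersectionStable.isClosed_wrap (h : IsIntersectionStable E 𝓐)
    {S : Set (EuclideanSpace ℝ (Fin d))} (hS : S ⊆ E) : IsClosed (wrap 𝓐 S) :=
  (h.isCompact_of_mem _ (h.wrap_mem hS)).isClosed

/-- As the hull is closed, a point outside it has a basic open neighbourhood `b` missing it; then
the hull lies in the compact set `E \ b`, an event covered by `MeasurableWrap`. -/
theorem measurableSet_notMem_wrap (hE : IsCompact E) (h : IsIntersectionStable E 𝓐)
    (hm : MeasurableWrap E 𝓐) (n : ℕ) :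
    MeasurableSet {p : (Fin n → EuclideanSpace ℝ (Fin d)) × EuclideanSpace ℝ (Fin d) |
      p.2 ∈ {y | Set.range p.1 ⊆ E ∧ y ∉ wrap 𝓐 (Set.range p.1)}} := by
  have heq : {p : (Fin n → EuclideanSpace ℝ (Fin d)) × EuclideanSpace ℝ (Fin d) |
      p.2 ∈ {y | Set.range p.1 ⊆ E ∧ y ∉ wrap 𝓐 (Set.range p.1)}} =
      ⋃ b ∈ TopologicalSpace.countableBasis (EuclideanSpace ℝ (Fin d)),
        {x : Fin n → EuclideanSpace ℝ (Fin d) |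
          (∀ i, x i ∈ E) ∧ wrap 𝓐 (Set.range x) ⊆ E \ b} ×ˢ b := by
    ext ⟨x, y⟩
    simp only [Set.mem_ofPred_eq, Set.mem_iUnion, Set.mem_prod, exists_prop]
    constructor
    · rintro ⟨hx, hy⟩
      obtain ⟨b, hb, hyb, hbs⟩ := (TopologicalSpace.isBasis_countableBasis
        (EuclideanSpace ℝ (Fin d))).exists_subset_of_mem_open (a := y)
        (u := (wrap 𝓐 (Set.range x))ᶜ) hy (h.isClosed_wrap hx).isOpen_compl
      exact ⟨b, hb, ⟨fun i => hx ⟨i, rfl⟩, fun z hz =>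
        ⟨h.subset_of_mem _ (h.wrap_mem hx) hz, fun hzb => hbs hzb hz⟩⟩, hyb⟩
    · rintro ⟨b, -, ⟨hx, hb⟩, hy⟩
      exact ⟨Set.range_subset_iff.2 hx, fun hyw => (hb hyw).2 hy⟩
  rw [heq]
  refine MeasurableSet.biUnion (TopologicalSpace.countable_countableBasis _) fun b hb => ?_
  have hb' := TopologicalSpace.isOpen_of_mem_countableBasis hb
  exact (hm n _ (hE.diff hb') Set.sdiff_subset).prod hb'.measurableSet

/-- A closed set contains an open set `b` as soon as it contains the points of a dense sequence
lying in `b`, so countably many conditions suffice. -/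
theorem measurableSet_mem_interior_wrap (hE : IsCompact E) (h : IsIntersectionStable E 𝓐)
    (hm : MeasurableWrap E 𝓐) (n : ℕ) :
    MeasurableSet {p : (Fin n → EuclideanSpace ℝ (Fin d)) × EuclideanSpace ℝ (Fin d) |
      p.2 ∈ {y | Set.range p.1 ⊆ E ∧ y ∈ interior (wrap 𝓐 (Set.range p.1))}} := by
  let D : ℕ → EuclideanSpace ℝ (Fin d) := TopologicalSpace.denseSeq _
  have hD : DenseRange D := TopologicalSpace.denseRange_denseSeq _
  have hEm : MeasurableSet {x : Fin n → EuclideanSpace ℝ (Fin d) | Set.range x ⊆ E} := by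
    simp only [Set.range_subset_iff, Set.ofPred_forall]
    exact MeasurableSet.iInter fun i => measurable_pi_apply i hE.measurableSet
  have heq : {p : (Fin n → EuclideanSpace ℝ (Fin d)) × EuclideanSpace ℝ (Fin d) |
      p.2 ∈ {y | Set.range p.1 ⊆ E ∧ y ∈ interior (wrap 𝓐 (Set.range p.1))}} =
      ⋃ b ∈ TopologicalSpace.countableBasis (EuclideanSpace ℝ (Fin d)),
        ({x : Fin n → EuclideanSpace ℝ (Fin d) | Set.range x ⊆ E} ∩
          ⋂ k ∈ {k | D k ∈ b}, {x : Fin n → EuclideanSpace ℝ (Fin d) |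
            Set.range x ⊆ E ∧ D k ∉ wrap 𝓐 (Set.range x)}ᶜ) ×ˢ b := by
    ext ⟨x, y⟩
    simp only [Set.mem_ofPred_eq, Set.mem_iUnion, Set.mem_prod, exists_prop, Set.mem_inter_iff,
      Set.mem_iInter, Set.mem_compl_iff, not_and, not_not]
    constructor
    · rintro ⟨hx, hy⟩
      obtain ⟨b, hb, hyb, hbs⟩ := (TopologicalSpace.isBasis_countableBasis
        (EuclideanSpace ℝ (Fin d))).exists_subset_of_mem_open hy isOpen_interior
      exact ⟨b, hb, ⟨hx, fun k hk _ => interior_subset (hbs hk)⟩, hyb⟩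
    · rintro ⟨b, hb, ⟨hx, hk⟩, hy⟩
      have hb' := TopologicalSpace.isOpen_of_mem_countableBasis hb
      refine ⟨hx, mem_interior.2 ⟨b, ?_, hb', hy⟩⟩
      refine (hD.open_subset_closure_inter hb').trans
        (closure_minimal ?_ (h.isClosed_wrap hx))
      rintro _ ⟨hzb, k, rfl⟩
      exact hk k hzb hx
  rw [heq]
  refine MeasurableSet.biUnion (TopologicalSpace.countable_countableBasis _) fun b hb => ?_
  have hb' := TopologicalSpace.isOpen_of_mem_countableBasis hb
  refine (hEm.inter (MeasurableSet.biInter (Set.to_countable _) fun k _ => ?_)).prod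
    hb'.measurableSet
  exact (measurable_prodMk_right (measurableSet_notMem_wrap hE h hm n)).compl

theorem measurableSet_mem_frontier_wrap (hE : IsCompact E) (h : IsIntersectionStable E 𝓐)
    (hm : MeasurableWrap E 𝓐) (n : ℕ) :
    MeasurableSet {p : (Fin n → EuclideanSpace ℝ (Fin d)) × EuclideanSpace ℝ (Fin d) |
      p.2 ∈ {y | Set.range p.1 ⊆ E ∧ y ∈ frontier (wrap 𝓐 (Set.range p.1))}} := by
  have hEm : MeasurableSet {p : (Fin n → EuclideanSpace ℝ (Fin d)) × EuclideanSpace ℝ (Fin d) |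
      Set.range p.1 ⊆ E} := by
    simp only [Set.range_subset_iff, Set.ofPred_forall]
    exact MeasurableSet.iInter fun i =>
      ((measurable_pi_apply i).comp measurable_fst) hE.measurableSet
  convert (hEm.diff (measurableSet_notMem_wrap hE h hm n)).diff
    (measurableSet_mem_interior_wrap hE h hm n) using 1
  ext ⟨x, y⟩
  simp only [Set.mem_ofPred_eq, Set.mem_sdiff, not_and, not_not]
  constructor
  · rintro ⟨hx, hy⟩
    rw [(h.isClosed_wrap hx).frontier_eq] at hy
    exact ⟨⟨hx, fun _ => hy.1⟩, fun _ => hy.2⟩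
  · rintro ⟨⟨hx, hy⟩, hi⟩
    rw [(h.isClosed_wrap hx).frontier_eq]
    exact ⟨hx, hy hx, hi hx⟩

theorem choose_card_le_card_exposedSubsets (x : ℕ → EuclideanSpace ℝ (Fin d)) (n q : ℕ)
    (hx : ∀ i, x i ∈ E) (B : Finset ℕ) (hB : B ⊆ Finset.range n)
    (hfr : ∀ i ∈ B, x i ∈ frontier (wrap 𝓐 (x '' ↑(Finset.range n))))
    (hempty : exposedSubsets (fun S => {y | S ⊆ E ∧ y ∈ frontier (wrap 𝓐 S)}) 1 n x = ∅) :
    B.card.choose q ≤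
      (exposedSubsets (fun S => {y | S ⊆ E ∧ y ∉ wrap 𝓐 S}) q n x).card := by
  classical
  have hxE (S : Set ℕ) : x '' S ⊆ E := by
    rintro _ ⟨i, -, rfl⟩
    exact hx i
  rw [← Finset.card_powersetCard]
  refine Finset.card_le_card fun T hT => ?_
  rw [Finset.mem_powersetCard] at hT
  refine mem_exposedSubsets.2 ⟨⟨hT.1.trans hB, hT.2⟩, fun i hi => ?_⟩
  refine ⟨hxE _, fun hmem => ?_⟩
  have hsub : wrap 𝓐 (x '' ↑(Finset.range n \ T)) ⊆ wrap 𝓐 (x '' ↑(Finset.range n \ {i})) :=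
    wrap_mono (Set.image_mono (Finset.coe_subset.2
      (Finset.sdiff_subset_sdiff subset_rfl (by simpa using hi))))
  -- If `x i` already lies in the hull of the points outside `T`, deleting it leaves the hull
  -- unchanged; `x i` is then on the frontier of the hull of the others, against `hempty`.
  have heq : wrap 𝓐 (x '' ↑(Finset.range n \ {i})) = wrap 𝓐 (x '' ↑(Finset.range n)) := by
    refine (wrap_mono (Set.image_mono (Finset.coe_subset.2 Finset.sdiff_subset))).antisymm
      (wrap_subset_wrap_of_subset ?_)
    rintro _ ⟨j, hj, rfl⟩
    by_cases hji : j = i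
    · exact hji ▸ hsub hmem
    · exact subset_wrap _ ⟨j, by simpa [hji] using hj, rfl⟩
  have hmem' : ({i} : Finset ℕ) ∈
      exposedSubsets (fun S => {y | S ⊆ E ∧ y ∈ frontier (wrap 𝓐 S)}) 1 n x := by
    refine mem_exposedSubsets.2 ⟨
      ⟨by simpa using hB (hT.1 hi), rfl⟩, fun j hj => ?_⟩
    obtain rfl := Finset.mem_singleton.1 hj
    exact ⟨hxE _, by rw [heq]; exact hfr j (hT.1 hi)⟩
  simp [hempty] at hmem'

end Wrap

/-! ### From binomial coefficients to powers. -/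

theorem Nat.pow_le_pow_self_mul_one_add_factorial_mul_choose (n q : ℕ) :
    n ^ q ≤ q ^ q * (1 + q.factorial * n.choose q) := by
  rw [← Nat.descFactorial_eq_factorial_mul_choose]
  -- The summand `1` serves `n < q`, where the binomial coefficient vanishes. Otherwise `n ≤ q * (n
  -- - q + 1)` for `q > 0`, and `n - q + 1` is the smallest factor of the descending factorial.
  rcases lt_or_ge n q with h | h
  · exact (Nat.pow_le_pow_left h.le q).trans (Nat.le_mul_of_pos_right _ (by positivity))
  · rcases Nat.eq_zero_or_pos q with rfl | hq
    · simp
    obtain ⟨m, rfl⟩ := Nat.exists_eq_add_of_le h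
    have h1 : q + m ≤ q * (m + 1) := by nlinarith
    have h2 := Nat.pow_sub_le_descFactorial (q + m) q
    rw [show q + m + 1 - q = m + 1 by omega] at h2
    calc (q + m) ^ q ≤ (q * (m + 1)) ^ q := Nat.pow_le_pow_left h1 q
      _ = q ^ q * (m + 1) ^ q := Nat.mul_pow ..
      _ ≤ _ := Nat.mul_le_mul_left _ (h2.trans (Nat.le_add_left _ _))

theorem observedPoints_eq_image {d : ℕ} {Ω : Type*}
    (X : ℕ → Ω → EuclideanSpace ℝ (Fin d)) (N : Ω → ℕ) (ω : Ω) :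
    observedPoints X N ω = (fun i => X i ω) '' ↑(Finset.range (N ω)) := by
  ext x
  simp [observedPoints]

/-! ### Efron's inequality for the Poisson sample. -/

section PoissonSample

variable {d : ℕ} {E : Set (EuclideanSpace ℝ (Fin d))}
  {𝓐 : Set (Set (EuclideanSpace ℝ (Fin d)))} {A : Set (EuclideanSpace ℝ (Fin d))}
  {lam : ℝ} {Ω : Type*} [MeasurableSpace Ω] {μ : Measure Ω}
  {X : ℕ → Ω → EuclideanSpace ℝ (Fin d)} {N : Ω → ℕ}

theorem measurable_card_exposedSubsets_comp {K : Set (EuclideanSpace ℝ (Fin d)) →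
    Set (EuclideanSpace ℝ (Fin d))}
    (hK : ∀ m, MeasurableSet {p : (Fin m → EuclideanSpace ℝ (Fin d)) ×
      EuclideanSpace ℝ (Fin d) | p.2 ∈ K (Set.range p.1)}) (q : ℕ)
    (hs : IsPoissonSample μ lam A X N) :
    Measurable fun ω => ((exposedSubsets K q (N ω) fun i => X i ω).card : ℝ≥0∞) := by
  exact measurable_comp_index_sequence hs.measurable_number hs.measurable_point
    (fun n x => ((exposedSubsets K q n x).card : ℝ≥0∞)) (measurable_card_exposedSubsets hK q)

/-- The mean `lam * |A|` cancels the normalisation `1 / |A|` of the uniform law. -/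
theorem IsPoissonSample.factorial_mul_lintegral_card_exposedSubsets [IsProbabilityMeasure μ]
    (hs : IsPoissonSample μ lam A X N) (hA : IsCompact A) (hA0 : 0 < volume A)
    {K : Set (EuclideanSpace ℝ (Fin d)) → Set (EuclideanSpace ℝ (Fin d))}
    (hK : ∀ m, MeasurableSet {p : (Fin m → EuclideanSpace ℝ (Fin d)) ×
      EuclideanSpace ℝ (Fin d) | p.2 ∈ K (Set.range p.1)}) (q : ℕ) :
    q.factorial * ∫⁻ ω, ((exposedSubsets K q (N ω) fun i => X i ω).card : ℝ≥0∞) ∂μ =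
      ENNReal.ofReal lam ^ q * ∫⁻ ω, volume (A ∩ K (observedPoints X N ω)) ^ q ∂μ := by
  have hAtop : volume A ≠ ∞ := hA.measure_lt_top.ne
  rw [_root_.factorial_mul_lintegral_card_exposedSubsets hs.measurable_point
    hs.iIndepFun_points hs.isUniform hs.measurable_number hs.map_number hs.indepFun_number hK q,
    ← lintegral_const_mul' _ _ (by finiteness), ← lintegral_const_mul' _ _ (by finiteness)]
  refine lintegral_congr fun ω => ?_
  rw [← mul_pow, ← mul_pow, ← observedPoints_eq_image, cond_apply hA.measurableSet]
  congr 1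
  have h1 : (((lam * (volume A).toReal).toNNReal : ℝ≥0) : ℝ≥0∞) =
      ENNReal.ofReal lam * volume A := by
    change ENNReal.ofReal _ = _
    rw [ENNReal.ofReal_mul' ENNReal.toReal_nonneg, ENNReal.ofReal_toReal hAtop]
  rw [h1, mul_assoc, ← mul_assoc (volume A), ENNReal.mul_inv_cancel hA0.ne' hAtop, one_mul]

theorem IsPoissonSample.ae_forall_mem (hs : IsPoissonSample μ lam A X N) (hA : IsCompact A) :
    ∀ᵐ ω ∂μ, ∀ i, X i ω ∈ A := by
  refine ae_all_iff.2 fun i => ?_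
  refine ae_of_ae_map (hs.measurable_point i).aemeasurable (p := fun x => x ∈ A) ?_
  rw [hs.isUniform i]
  exact ae_cond_mem hA.measurableSet

theorem IsPoissonSample.ae_exposedSubsets_frontier_eq_empty [IsProbabilityMeasure μ]
    (hs : IsPoissonSample μ lam A X N) (hE : IsCompact E) (h : IsIntersectionStable E 𝓐)
    (hm : MeasurableWrap E 𝓐) (hA : IsCompact A) (hA0 : 0 < volume A)
    (hfr : ∀ᵐ ω ∂μ, volume (frontier (wrappingHull 𝓐 X N ω)) = 0) :
    ∀ᵐ ω ∂μ, exposedSubsets (fun S => {y | S ⊆ E ∧ y ∈ frontier (wrap 𝓐 S)}) 1 (N ω)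
      (fun i => X i ω) = ∅ := by
  have hK := measurableSet_mem_frontier_wrap hE h hm
  have h1 := hs.factorial_mul_lintegral_card_exposedSubsets hA hA0
    (K := fun S => {y | S ⊆ E ∧ y ∈ frontier (wrap 𝓐 S)}) hK 1
  have h2 : ∫⁻ ω, volume (A ∩ {y | observedPoints X N ω ⊆ E ∧
      y ∈ frontier (wrap 𝓐 (observedPoints X N ω))}) ^ 1 ∂μ = 0 := by
    refine (lintegral_congr_ae ?_).trans lintegral_zero
    filter_upwards [hfr] with ω hω
    rw [pow_one]
    exact measure_mono_null (fun y hy => hy.2.2) hω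
  rw [h2, mul_zero, Nat.factorial_one, Nat.cast_one, one_mul, lintegral_eq_zero_iff
    (measurable_card_exposedSubsets_comp hK 1 hs)] at h1
  filter_upwards [h1] with ω hω
  simpa using hω

theorem IsPoissonSample.ae_choose_boundaryCount_le [IsProbabilityMeasure μ]
    (hs : IsPoissonSample μ lam A X N) (hE : IsCompact E) (h : IsIntersectionStable E 𝓐)
    (hm : MeasurableWrap E 𝓐) (hA : A ∈ 𝓐) (hA0 : 0 < volume A)
    (hfr : ∀ᵐ ω ∂μ, volume (frontier (wrappingHull 𝓐 X N ω)) = 0) (q : ℕ) :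
    ∀ᵐ ω ∂μ, (boundaryCount 𝓐 X N ω).choose q ≤
      (exposedSubsets (fun S => {y | S ⊆ E ∧ y ∉ wrap 𝓐 S}) q (N ω) fun i => X i ω).card := by
  have hA' := h.isCompact_of_mem A hA
  filter_upwards [hs.ae_exposedSubsets_frontier_eq_empty hE h hm hA' hA0 hfr,
    hs.ae_forall_mem hA'] with ω hω hωA
  classical
  refine choose_card_le_card_exposedSubsets _ _ q (fun i => h.subset_of_mem A hA (hωA i)) _
    (Finset.filter_subset _ _) (fun i hi => ?_) hω
  rw [← observedPoints_eq_image]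
  exact (Finset.mem_filter.1 hi).2

/-- Efron's inequality for the wrapping hull, with an explicit constant. -/
theorem IsPoissonSample.lintegral_boundaryCount_pow_le [IsProbabilityMeasure μ]
    (hs : IsPoissonSample μ lam A X N) (hE : IsCompact E) (h : IsIntersectionStable E 𝓐)
    (hm : MeasurableWrap E 𝓐) (hA : A ∈ 𝓐) (hA0 : 0 < volume A)
    (hfr : ∀ᵐ ω ∂μ, volume (frontier (wrappingHull 𝓐 X N ω)) = 0) (q : ℕ)
    (hp : 0 < μ.real {ω | q ≤ boundaryCount 𝓐 X N ω}) :
    ∫⁻ ω, (boundaryCount 𝓐 X N ω : ℝ≥0∞) ^ q ∂μ ≤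
      ENNReal.ofReal ((q : ℝ) ^ q * (1 + (μ.real {ω | q ≤ boundaryCount 𝓐 X N ω})⁻¹)) *
        (ENNReal.ofReal lam ^ q * ∫⁻ ω, volume (A \ wrappingHull 𝓐 X N ω) ^ q ∂μ) := by
  have hK := measurableSet_notMem_wrap hE h hm
  set G : Ω → ℕ := fun ω =>
    (exposedSubsets (fun S => {y | S ⊆ E ∧ y ∉ wrap 𝓐 S}) q (N ω) fun i => X i ω).card
  have hG : Measurable fun ω => (G ω : ℝ≥0∞) := measurable_card_exposedSubsets_comp hK q hs
  have hle := hs.ae_choose_boundaryCount_le hE h hm hA hA0 hfr q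
  set R := ENNReal.ofReal lam ^ q * ∫⁻ ω, volume (A \ wrappingHull 𝓐 X N ω) ^ q ∂μ
  have hR : q.factorial * ∫⁻ ω, (G ω : ℝ≥0∞) ∂μ ≤ R := by
    rw [hs.factorial_mul_lintegral_card_exposedSubsets (h.isCompact_of_mem A hA) hA0
      (K := fun S => {y | S ⊆ E ∧ y ∉ wrap 𝓐 S}) hK q]
    refine mul_le_mul_right (lintegral_mono fun ω => ?_) _
    refine pow_le_pow_left₀ zero_le (measure_mono (Set.inter_subset_inter_right A ?_)) q
    exact fun y hy => hy.2
  -- On this event the binomial coefficient is at least `1`, hence so is `G`, and Markov's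
  -- inequality applies. This bounds the additive `1` by `p⁻¹ * R`.
  have hpR : μ {ω | q ≤ boundaryCount 𝓐 X N ω} ≤ R := by
    calc μ {ω | q ≤ boundaryCount 𝓐 X N ω} ≤ μ {ω | 1 ≤ (G ω : ℝ≥0∞)} := by
          refine measure_mono_ae ?_
          filter_upwards [hle] with ω hω hq
          exact Nat.one_le_cast.2 ((Nat.choose_pos hq).trans_le hω)
      _ ≤ ∫⁻ ω, (G ω : ℝ≥0∞) ∂μ := by simpa using mul_meas_ge_le_lintegral hG 1
      _ ≤ q.factorial * ∫⁻ ω, (G ω : ℝ≥0∞) ∂μ :=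
          le_mul_of_one_le_left zero_le (Nat.one_le_cast.2 q.factorial_pos)
      _ ≤ R := hR
  set p := μ.real {ω | q ≤ boundaryCount 𝓐 X N ω}
  have hp' : ENNReal.ofReal p ≤ R := by
    rwa [ofReal_measureReal (measure_ne_top _ _)]
  have hone : 1 ≤ ENNReal.ofReal p⁻¹ * R := by
    calc 1 = ENNReal.ofReal p⁻¹ * ENNReal.ofReal p := by
          rw [← ENNReal.ofReal_mul (by positivity), inv_mul_cancel₀ hp.ne', ENNReal.ofReal_one]
      _ ≤ _ := mul_le_mul_right hp' _
  calc ∫⁻ ω, (boundaryCount 𝓐 X N ω : ℝ≥0∞) ^ q ∂μ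
      ≤ ∫⁻ ω, (q : ℝ≥0∞) ^ q * (1 + q.factorial * G ω) ∂μ := by
        refine lintegral_mono_ae ?_
        filter_upwards [hle] with ω hω
        have := (Nat.pow_le_pow_self_mul_one_add_factorial_mul_choose
          (boundaryCount 𝓐 X N ω) q).trans (Nat.mul_le_mul_left _
            (Nat.add_le_add_left (Nat.mul_le_mul_left _ hω) 1))
        exact_mod_cast this
    _ = (q : ℝ≥0∞) ^ q * (1 + q.factorial * ∫⁻ ω, (G ω : ℝ≥0∞) ∂μ) := by
        rw [lintegral_const_mul' _ _ (by finiteness), lintegral_add_left measurable_const,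
          lintegral_const_mul' _ _ (by finiteness)]
        simp
    _ ≤ (q : ℝ≥0∞) ^ q * (ENNReal.ofReal p⁻¹ * R + R) :=
        mul_le_mul_right (add_le_add hone hR) _
    _ = _ := by
        rw [ENNReal.ofReal_mul (by positivity), ENNReal.ofReal_add zero_le_one (by positivity),
          ENNReal.ofReal_pow (by positivity), ENNReal.ofReal_natCast, ENNReal.ofReal_one]
        ring

end PoissonSample

theorem mainTheorem5 (q : ℕ) :
    ∃ C : ℝ → ℝ, AntitoneOn C (Set.Ioi 0) ∧
      ∀ (d : ℕ) (E : Set (EuclideanSpace ℝ (Fin d)))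
        (𝓐 : Set (Set (EuclideanSpace ℝ (Fin d)))) (A : Set (EuclideanSpace ℝ (Fin d)))
        (lam : ℝ) (Ω : Type*) [MeasurableSpace Ω] (μ : Measure Ω) [IsProbabilityMeasure μ]
        (X : ℕ → Ω → EuclideanSpace ℝ (Fin d)) (N : Ω → ℕ),
        IsCompact E → Convex ℝ E →
        IsIntersectionStable E 𝓐 → MeasurableWrap E 𝓐 →
        A ∈ 𝓐 → 0 < volume A → 0 < lam →
        IsPoissonSample μ lam A X N →
        (∀ᵐ ω ∂μ, volume (frontier (wrappingHull 𝓐 X N ω)) = 0) →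
        0 < μ.real {ω | q ≤ boundaryCount 𝓐 X N ω} →
        ∫⁻ ω, (boundaryCount 𝓐 X N ω : ℝ≥0∞) ^ q ∂μ ≤
          ENNReal.ofReal (C (μ.real {ω | q ≤ boundaryCount 𝓐 X N ω})) *
            (ENNReal.ofReal lam ^ q *
              ∫⁻ ω, volume (A \ wrappingHull 𝓐 X N ω) ^ q ∂μ) := by
  -- The term `1` comes from Mecke's formula, the term `p⁻¹` from absorbing the additive constant.
  refine ⟨fun p => (q : ℝ) ^ q * (1 + p⁻¹), fun a ha b _ hab => ?_, ?_⟩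
  · have : b⁻¹ ≤ a⁻¹ := inv_anti₀ ha hab
    exact mul_le_mul_of_nonneg_left (by linarith) (by positivity)
  · intro d E 𝓐 A lam Ω _ μ _ X N hE _ h hm hA hA0 _ hs hfr hp
    exact hs.lintegral_boundaryCount_pow_le hE h hm hA hA0 hfr q hp
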